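/- A finite extensive-form game consists of a finite set $N$ of players, a finite set $A$ of actions, a finite prefix-closed set $H$ of finite action sequences (histories) containing the empty one, with terminal histories $Z$ (those that no other history extends), a function assigning to each non-terminal history the player or chance who acts there, fixed chance probabilities, utilities $u_i:Z\to\mathbb R$, and for each player $i$ a partition $\mathcal I_i$ of the histories $H_i$ at which $i$ acts into information sets, such that the same actions $A(I)$ are available throughout an information set $I$ and no information set is met twice in one play. Write $h\sqsubseteq z$ if $h$ is a prefix of $z$, $Z_I$ for the terminal histories with a prefix in $I$, and $z[I]$ for that prefix. Let $X_i(h,h')$ be the ordered sequence of (information set, action) pairs of player $i$ on the way from $h$ to $h'$, let $X_i(h)=X_i(\emptyset,h)$, and let $X_{-i}(h)$ be the ordered sequence of the pairs of all players other than $i$ (chance has none) on the way to $h$. The game has perfect recall if $X_i(h)=X_i(h')$ for all $i$ and all $h,h'$ in the same information set of $i$. A strategy profile $\sigma$ (behavioural, constant on information sets) reaches $h'$ from $h$ with probability $\pi^\sigma(h,h')$, the product of the contributions of all players and chance; $\pi^\sigma_{-i}(h)$ is the contribution of everyone (chance included) except $i$ to reaching $h$ from the root, $\pi_c(h)$ is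 that of chance alone, and $u_i(\sigma)=\sum_{z\in Z}u_i(z)\pi^\sigma(\emptyset,z)$. Let $\Gamma$ and $\breve\Gamma$ be games that differ only in their information partitions $\mathcal I$ and $\breve{\mathcal I}$. $\breve\Gamma$ is a perfect recall refinement of $\Gamma$ if $\breve\Gamma$ has perfect recall and any two histories of a player in the same information set of $\breve\Gamma$ are in the same information set of $\Gamma$. For $I\in\mathcal I_i$ let $\breve{\mathcal P}(I)=\{J\in\breve{\mathcal I}_i: J\subseteq I\}$. $\Gamma$ is well-formed with respect to such a $\breve\Gamma$, with constants $k_{J,J'},\ell_{J,J'}\in[0,\infty)$, if for all $i\in N$, $I\in\mathcal I_i$ and $J,J'\in\breve{\mathcal P}(I)$ there is a bijection $\phi:Z_J\to Z_{J'}$ such that for all $z\in Z_J$: (i) $u_i(z)=k_{J,J'}\,u_i(\phi(z))$; (ii) $\pi_c(z)=\ell_{J,J'}\,\pi_c(\phi(z))$; (iii) $X_{-i}(z)=X_{-i}(\phi(z))$ in $\Gamma$; (iv) $X_i(z[J],z)=X_i(\phi(z)[J'],\phi(z))$ in $\Gamma$. Player $i$ chooses strategies according to counterfactual regret minimization (CFR)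 in $\Gamma$ if the profiles $\sigma^1,\sigma^2,\dots$ of $\Gamma$ satisfy, for all $T\ge 0$, $I\in\mathcal I_i$, $a\in A(I)$, $$\sigma_i^{T+1}(I,a)=\frac{R_i^{T,+}(I,a)}{\sum_{b\in A(I)}R_i^{T,+}(I,b)}\quad\text{(and }1/|A(I)|\text{ if the denominator is }0),$$ where $x^+=\max\{x,0\}$, $R_i^T(I,a)=\sum_{t=1}^T\big(v_i(\sigma^t_{I\to a},I)-v_i(\sigma^t,I)\big)$, $v_i(\sigma,I)=\sum_{z\in Z_I}u_i(z)\pi^\sigma_{-i}(z[I])\pi^\sigma(z[I],z)$, and $\sigma_{I\to a}$ is $\sigma$ except that $a$ is always taken at $I$. The other players' strategies in $\Gamma$ are arbitrary (for instance also chosen by CFR). Let $\breve R_i^T=\max_{\sigma'}\sum_{t=1}^T\big(u_i(\sigma',\sigma_{-i}^t)-u_i(\sigma^t)\big)$ be the external regret in $\breve\Gamma$, where $\sigma'$ ranges over the strategies of player $i$ in $\breve\Gamma$; $R_i^T$ denotes the same with the strategies of player $i$ in $\Gamma$. **Theorem.** Let player $i$ choose strategies according to CFR in $\Gamma$. If $\Gamma$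 is well-formed with respect to $\breve\Gamma$ with constants $k_{J,J'},\ell_{J,J'}$, then for all $T\ge1$ $$\frac{\breve R_i^T}{T}\le\frac{\Delta_i K\sqrt{|A_i|}}{\sqrt T},\qquad K=\sum_{I\in\mathcal I_i}\ \max_{J,J'\in\breve{\mathcal P}(I)}k_{J,J'}\,\ell_{J,J'},$$ where $\Delta_i=\max_{z,z'\in Z}(u_i(z)-u_i(z'))$ and $|A_i|=\max_{I\in\mathcal I_i}|A(I)|$; in particular $\lim_{T\to\infty}\breve R_i^{T,+}/T=0$, that is, CFR in $\Gamma$, which may have imperfect recall, minimizes regret in the full game $\breve\Gamma$. If $\Gamma$ itself has perfect recall, then it is well-formed with respect to itself with all constants equal to $1$, and for all $T\ge1$ the original CFR bound $R_i^T/T\le\Delta_i|\mathcal I_i|\sqrt{|A_i|}/\sqrt T$ holds. -/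

import Mathlib

open Filter Topology

/-- The part of a finite extensive-form game that does not concern information:
players `N`, actions `A`, histories, player function, chance and utilities.
`player h = none` means that chance acts at `h`; the values of `player` at terminal histories, of
`chance` away from chance histories and of `utility` away from terminal histories play no role. -/
structure GameTree (N A : Type*) [Fintype N] [DecidableEq N] [Fintype A] [DecidableEq A] where
  /-- The finite set `H` of histories (finite sequences of actions). -/
  hist : Finset (List A)
  nil_mem : [] ∈ hist
  prefix_mem : ∀ h h' : List A, h' ∈ hist → h <+: h' → h ∈ hist
  /-- The player to act. -/
  player : List A → Option N
  /-- `chance h a` is the probability that chance event `a` occurs at `h`. -/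
  chance : List A → A → ℝ
  /-- `utility i z` is the utility of player `i` at the terminal history `z`. -/
  utility : N → List A → ℝ
  chance_nonneg : ∀ h a, h ++ [a] ∈ hist → player h = none → 0 ≤ chance h a
  chance_sum : ∀ h ∈ hist, (∃ a, h ++ [a] ∈ hist) → player h = none →
    ∑ a with h ++ [a] ∈ hist, chance h a = 1

namespace GameTree

variable {N A : Type*} [Fintype N] [DecidableEq N] [Fintype A] [DecidableEq A]

/-- `A(h)`, the set of valid actions at `h`. -/
def acts (G : GameTree N A) (h : List A) : Finset A := {a | h ++ [a] ∈ G.hist}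

/-- `Z`, the set of terminal histories. -/
def terminal (G : GameTree N A) : Finset (List A) :=
  {z ∈ G.hist | ∀ h ∈ G.hist, z <+: h → h = z}

/-- `H_i`, the (non-terminal) histories at which player `i` acts. -/
def playerHist (G : GameTree N A) (i : N) : Finset (List A) :=
  {h ∈ G.hist | h ∉ G.terminal ∧ G.player h = some i}

/-- The actions available at a set `I` of histories (for an information set this is `A(h)` for
any `h ∈ I`). -/
def actsAt (G : GameTree N A) (I : Finset (List A)) : Finset A := I.biUnion G.acts

/-- The pairs `(g, a)` with `h ⊑ g` and `g a ⊑ h'`, in the order in which they occur on the way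
from `h` to `h'`; empty if `h` is not a prefix of `h'`. -/
def steps (h h' : List A) : List (List A × A) :=
  if h <+: h' then (h'.inits.zip h').drop h.length else []

/-- The product of `f g a` over the steps `(g, a)` from `h` to `h'` at which `o` acts, where `o` is
a player or chance. -/
def pathProd (G : GameTree N A) (f : List A → A → ℝ) (o : Option N) (h h' : List A) : ℝ :=
  (((steps h h').filter fun p => G.player p.1 = o).map fun p => f p.1 p.2).prod

/-- The behaviour of a player or of chance under the strategy profile `σ`. -/
def behaviour (G : GameTree N A) (σ : N → List A → A → ℝ) : Option N → List A → A → ℝ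
  | none => G.chance
  | some i => σ i

/-- `π^σ(h, h')`: the contributions of all players and of chance. -/
def reach (G : GameTree N A) (σ : N → List A → A → ℝ) (h h' : List A) : ℝ :=
  ∏ o, G.pathProd (G.behaviour σ o) o h h'

/-- `π_{-i}^σ(h)`: the contributions of chance and of all players except `i`. -/
def reachOthers (G : GameTree N A) (σ : N → List A → A → ℝ) (i : N) (h : List A) : ℝ :=
  ∏ o ∈ Finset.univ.erase (some i), G.pathProd (G.behaviour σ o) o [] h

/-- `π_c(h)`: the contribution of chance. -/
def reachChance (G : GameTree N A) (h : List A) : ℝ := G.pathProd G.chance none [] h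

/-- `u_i(σ)`, the expected utility of player `i` under the profile `σ`. -/
def expectedUtility (G : GameTree N A) (i : N) (σ : N → List A → A → ℝ) : ℝ :=
  ∑ z ∈ G.terminal, G.utility i z * G.reach σ [] z

/-- `Δ_i`, the largest difference between two utilities of player `i`. -/
noncomputable def range (G : GameTree N A) (i : N) : ℝ :=
  ⨆ p : ↥(G.terminal ×ˢ G.terminal), (G.utility i p.1.1 - G.utility i p.1.2)

/-- `Z_I`, the terminal histories with a prefix in `I`. -/
def through (G : GameTree N A) (I : Finset (List A)) : Finset (List A) :=
  {z ∈ G.terminal | ∃ h ∈ I, h <+: z}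

/-- `z[I]`, the prefix of `z` contained in `I` (unique if `I` is an information set). -/
def prefixIn (I : Finset (List A)) (z : List A) : List A :=
  (z.inits.find? fun h => h ∈ I).getD []

/-- The counterfactual value `v_i(σ, I)`. -/
def cfValue (G : GameTree N A) (i : N) (σ : N → List A → A → ℝ) (I : Finset (List A)) : ℝ :=
  ∑ z ∈ G.through I,
    G.utility i z * G.reachOthers σ i (prefixIn I z) * G.reach σ (prefixIn I z) z

/-- `σ_{I → a}`: the profile `σ`, except that player `i` always takes action `a` at `I`. -/
def switchTo (σ : N → List A → A → ℝ) (i : N) (I : Finset (List A)) (a : A) :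
    N → List A → A → ℝ :=
  Function.update σ i fun h b => if h ∈ I then (if b = a then 1 else 0) else σ i h b

/-- The immediate counterfactual regret `R_i^T(I, a)` for the profiles `σ 1, …, σ T`. -/
def cfRegret (G : GameTree N A) (i : N) (σ : ℕ → N → List A → A → ℝ) (T : ℕ)
    (I : Finset (List A)) (a : A) : ℝ :=
  ∑ t ∈ Finset.Icc 1 T, (G.cfValue i (switchTo (σ t) i I a) I - G.cfValue i (σ t) I)

end GameTree

/-- An information structure on a game tree: a partition of the histories of each player into
information sets, with the same actions available throughout an information set, and such that no
information set is met twice in a single play. A game tree together with an information structure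
is a game. -/
structure Info {N A : Type*} [Fintype N] [DecidableEq N] [Fintype A] [DecidableEq A]
    (G : GameTree N A) where
  /-- The information partition of each player. -/
  partition : (i : N) → Finpartition (G.playerHist i)
  acts_eq : ∀ i, ∀ I ∈ (partition i).parts, ∀ h ∈ I, ∀ h' ∈ I, G.acts h = G.acts h'
  no_repeat : ∀ i, ∀ I ∈ (partition i).parts, ∀ h ∈ I, ∀ h' ∈ I, h <+: h' → h = h'

namespace Info

variable {N A : Type*} [Fintype N] [DecidableEq N] [Fintype A] [DecidableEq A]
  {G : GameTree N A}

/-- `I(h)`, the information set containing `h`. -/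
def infoSet (Γ : Info G) (h : List A) : Finset (List A) :=
  match G.player h with
  | some i => (Γ.partition i).part h
  | none => ∅

/-- `X_i(h, h')`: player `i`'s information set, action pairs from `h` to `h'`, in order. -/
def seqOwn (Γ : Info G) (i : N) (h h' : List A) : List (Finset (List A) × A) :=
  ((GameTree.steps h h').filter fun p => G.player p.1 = some i).map
    fun p => (Γ.infoSet p.1, p.2)

/-- `X_{-i}(h)`: the information set, action pairs of all players except `i` (chance has no
information sets) on the way to `h`, in order. -/
def seqOthers (Γ : Info G) (i : N) (h : List A) : List (Finset (List A) × A) :=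
  ((GameTree.steps [] h).filter fun p => G.player p.1 ≠ none ∧ G.player p.1 ≠ some i).map
    fun p => (Γ.infoSet p.1, p.2)

/-- Perfect recall. -/
def PerfectRecall (Γ : Info G) : Prop :=
  ∀ i, ∀ I ∈ (Γ.partition i).parts, ∀ h ∈ I, ∀ h' ∈ I, Γ.seqOwn i [] h = Γ.seqOwn i [] h'

/-- `Γ` is an abstraction of `Γ'` (with the same actions): histories that a player cannot
distinguish in `Γ'` cannot be distinguished in `Γ`. -/
def IsAbstractionOf (Γ Γ' : Info G) : Prop :=
  ∀ i, ∀ h ∈ G.playerHist i, ∀ h' ∈ G.playerHist i,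
    Γ'.infoSet h = Γ'.infoSet h' → Γ.infoSet h = Γ.infoSet h'

/-- `Γ'` is a perfect recall refinement of `Γ`. -/
def IsPerfectRecallRefinement (Γ' Γ : Info G) : Prop :=
  Γ'.PerfectRecall ∧ Γ.IsAbstractionOf Γ'

/-- The information sets of player `i` in `Γ'` that are subsets of `I`. -/
def subInfoSets (Γ' : Info G) (i : N) (I : Finset (List A)) : Finset (Finset (List A)) :=
  {J ∈ (Γ'.partition i).parts | J ⊆ I}

/-- `Γ` is well-formed with respect to its perfect recall refinement `Γ'`, with proportionality
constants `k J J'` for the utilities and `l J J'` for the chance probabilities. -/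
def WellFormed (Γ Γ' : Info G) (k l : Finset (List A) → Finset (List A) → ℝ) : Prop :=
  Γ'.IsPerfectRecallRefinement Γ ∧
  ∀ i, ∀ I ∈ (Γ.partition i).parts, ∀ J ∈ Γ'.subInfoSets i I, ∀ J' ∈ Γ'.subInfoSets i I,
    0 ≤ k J J' ∧ 0 ≤ l J J' ∧
    ∃ φ : List A → List A, Set.BijOn φ (G.through J) (G.through J') ∧
      ∀ z ∈ G.through J,
        G.utility i z = k J J' * G.utility i (φ z) ∧
        G.reachChance z = l J J' * G.reachChance (φ z) ∧
        Γ.seqOthers i z = Γ.seqOthers i (φ z) ∧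
        Γ.seqOwn i (GameTree.prefixIn J z) z =
          Γ.seqOwn i (GameTree.prefixIn J' (φ z)) (φ z)

/-- `K = ∑_I max_{J, J'} k J J' * l J J'`, the sum over the information sets `I` of player `i` in
`Γ` and the maximum over the information sets `J, J' ⊆ I` of `Γ'`. -/
noncomputable def wfConst (Γ Γ' : Info G) (k l : Finset (List A) → Finset (List A) → ℝ)
    (i : N) : ℝ :=
  ∑ I ∈ (Γ.partition i).parts,
    ⨆ p : ↥(Γ'.subInfoSets i I ×ˢ Γ'.subInfoSets i I), k p.1.1 p.1.2 * l p.1.1 p.1.2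

/-- `|A_i|`, the largest number of actions at an information set of player `i`. -/
def maxActs (Γ : Info G) (i : N) : ℕ :=
  (Γ.partition i).parts.sup fun I => (G.actsAt I).card

/-- `s ∈ Σ_i`: `s` is a behavioural strategy of player `i` in `Γ`. Its values away from the
histories of player `i` play no role. -/
def IsStrategy (Γ : Info G) (i : N) (s : List A → A → ℝ) : Prop :=
  (∀ h ∈ G.playerHist i, (∀ a, 0 ≤ s h a) ∧ (∀ a, a ∉ G.acts h → s h a = 0) ∧
    ∑ a ∈ G.acts h, s h a = 1) ∧
  ∀ I ∈ (Γ.partition i).parts, ∀ h ∈ I, ∀ h' ∈ I, s h = s h'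

/-- The external regret `R_i^T` in `Γ` for the profiles `σ 1, …, σ T`. The supremum is a maximum:
it is over a continuous function of the finitely many probabilities of a strategy of player `i`. -/
noncomputable def regret (Γ : Info G) (i : N) (σ : ℕ → N → List A → A → ℝ) (T : ℕ) : ℝ :=
  sSup {x | ∃ s, Γ.IsStrategy i s ∧
    x = ∑ t ∈ Finset.Icc 1 T, (G.expectedUtility i (Function.update (σ t) i s) -
      G.expectedUtility i (σ t))}

/-- The profiles `σ 1, σ 2, …` are strategy profiles of `Γ` in which player `i` follows
counterfactual regret minimization in `Γ`: at each of her information sets she plays, in iteration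
`T + 1`, regret matching on the immediate counterfactual regrets `R_i^T(I, a)`. In particular her
first strategy is uniform. The strategies of the other players are arbitrary, and may follow the
same algorithm. -/
def IsCFR (Γ : Info G) (i : N) (σ : ℕ → N → List A → A → ℝ) : Prop :=
  (∀ t ≥ 1, ∀ j, Γ.IsStrategy j (σ t j)) ∧
  ∀ T : ℕ, ∀ I ∈ (Γ.partition i).parts, ∀ h ∈ I, ∀ a ∈ G.actsAt I,
    σ (T + 1) i h a =
      if 0 < ∑ b ∈ G.actsAt I, max (G.cfRegret i σ T I b) 0 then
        max (G.cfRegret i σ T I a) 0 / ∑ b ∈ G.actsAt I, max (G.cfRegret i σ T I b) 0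
      else 1 / ((G.actsAt I).card : ℝ)

end Info

/-! Replace `σ i` by a deviation `s` one decision at a time. Along each path the difference of the
two contributions telescopes, so the gain of `s` is a sum over the histories `h` of player `i`: the
contribution of `s` to reaching `h`, times the gain from using `s` once at `h` and `σ` afterwards
(`expectedUtility_update_sub`). This needs no recall. Perfect recall of `Γ'` makes the weight the
same throughout an information set `J` of `Γ'`, so the regret is the sum over `I` and `J ⊆ I` of `w
J * ∑ a, p J a * r J a`, where `r J` is the immediate counterfactual regret at `J` and `p J` the
choice of `s` there (`sum_expectedUtility_sub_eq`).

CFR in `Γ` only sees `∑ J, r J` at `I`. Reindexing terminal histories along the bijections of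
well-formedness gives `r J = k J J₀ * l J J₀ * r J₀` for a fixed `J₀ ⊆ I` (`WellFormed.cfValue_eq`).
All regrets inside `I` are thus multiples of one vector, and regret matching on their sum is regret
matching on `r J₀`, to which the usual potential argument applies: the play is orthogonal to the
positive regrets, so their squared norm grows at most linearly in `T`.

In `weighted_regret_le` this argument is run on `r J₀` scaled by `∑ J, w J * k J J₀ * l J J₀`. One
step of the scaled regret is at most `Δ_i` times the probability that `s` with the others'
strategies meets `I`, and this probability is at most one because `I` is met at most once per play.
The maximum in `K` enters only at the end, through its term at `(J₀, J₀)`, which is one unless the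
regrets vanish. -/

namespace GameTree

/-! ### Steps along a path -/

section Steps

variable {A : Type*}

theorem exists_concat_prefix {h z : List A} (hz : h <+: z) (hne : z ≠ h) :
    ∃ a, h ++ [a] <+: z := by
  obtain ⟨t, rfl⟩ := hz
  cases t with
  | nil => simp at hne
  | cons a t => exact ⟨a, by simp⟩

theorem concat_prefix_unique {h z : List A} {a b : A} (ha : h ++ [a] <+: z) (hb : h ++ [b] <+: z) :
    a = b := by
  have := (List.prefix_of_prefix_length_le ha hb (by simp)).eq_of_length (by simp)
  simpa using this

/-- `inits` is one longer than the list, so `zip` drops the full list and each action is paired with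
the history before it. -/
theorem zip_inits_concat (l : List A) (a : A) :
    (l ++ [a]).inits.zip (l ++ [a]) = l.inits.zip l ++ [(l, a)] := by
  apply List.ext_getElem
  · simp
  · intro n h₁ h₂
    simp only [List.length_zip, List.length_inits, List.length_append, List.length_singleton] at h₁
    have hn : n ≤ l.length := by omega
    rcases hn.lt_or_eq with hn | rfl
    · rw [List.getElem_append_left (by simp [hn])]
      simp [List.getElem_append_left hn, hn.le]
    · simp

variable [DecidableEq A]

theorem steps_self (h : List A) : steps h h = [] := by
  simp [steps]

theorem steps_concat {h z : List A} (hz : h <+: z) (a : A) :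
    steps h (z ++ [a]) = steps h z ++ [(z, a)] := by
  rw [steps, steps, if_pos hz, if_pos (hz.trans (List.prefix_append _ _)), zip_inits_concat,
    List.drop_append_of_le_length]
  simpa using hz.length_le

theorem steps_append {h g z : List A} (hg : h <+: g) (hz : g <+: z) :
    steps h z = steps h g ++ steps g z := by
  obtain ⟨t, rfl⟩ := hz
  induction t using List.reverseRecOn with
  | nil => simp [steps_self]
  | append_singleton t a ih =>
    rw [← List.append_assoc, steps_concat (hg.trans (List.prefix_append _ _)), ih,
      steps_concat (List.prefix_append _ _), List.append_assoc]

theorem prefix_of_mem_steps {h z : List A} {p : List A × A} (hp : p ∈ steps h z) :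
    h <+: p.1 ∧ p.1 ++ [p.2] <+: z := by
  by_cases hz : h <+: z
  · obtain ⟨t, rfl⟩ := hz
    induction t using List.reverseRecOn with
    | nil => simp [steps_self] at hp
    | append_singleton t a ih =>
      rw [← List.append_assoc, steps_concat (List.prefix_append _ _), List.mem_append,
        List.mem_singleton] at hp
      rcases hp with hp | rfl
      · exact ⟨(ih hp).1, (ih hp).2.trans (by simp)⟩
      · simp
  · simp [steps, hz] at hp

/-- Two prefixes of one history are comparable, so a set of incomparable histories contains at most
one of them. -/
theorem prefixIn_eq {J : Finset (List A)} (hJ : ∀ h ∈ J, ∀ h' ∈ J, h <+: h' → h = h')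
    {h z : List A} (hh : h ∈ J) (hz : h <+: z) : prefixIn J z = h := by
  unfold prefixIn
  cases hf : z.inits.find? fun h => h ∈ J with
  | none =>
    rw [List.find?_eq_none] at hf
    exact absurd hh (by simpa using hf h (by simpa using hz))
  | some g =>
    have hg : g ∈ J := by simpa using List.find?_some hf
    have hgz : g <+: z := by simpa using List.mem_of_find?_eq_some hf
    rcases List.prefix_or_prefix_of_prefix hgz hz with h' | h'
    · exact hJ _ hg _ hh h'
    · exact (hJ _ hh _ hg h').symm

theorem sum_prefixes {J : Finset (List A)} (hJ : ∀ h ∈ J, ∀ h' ∈ J, h <+: h' → h = h')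
    (f : List A → ℝ) (z : List A) :
    (∑ h ∈ J, if h <+: z then f h else 0) =
      if ∃ h ∈ J, h <+: z then f (prefixIn J z) else 0 := by
  split_ifs with hz
  · obtain ⟨h, hh, hz⟩ := hz
    rw [prefixIn_eq hJ hh hz, Finset.sum_eq_single_of_mem h hh, if_pos hz]
    intro g hg hne
    rw [if_neg]
    exact fun hgz => hne ((prefixIn_eq hJ hg hgz).symm.trans (prefixIn_eq hJ hh hz))
  · exact Finset.sum_eq_zero fun h hh => if_neg fun hp => hz ⟨h, hh, hp⟩

variable {N : Type*} [DecidableEq N]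

/-! ### Profiles switched to a fixed action -/

theorem switchTo_of_ne (σ : N → List A → A → ℝ) {i j : N} (hj : j ≠ i) (I : Finset (List A))
    (a : A) : switchTo σ i I a j = σ j :=
  Function.update_of_ne hj _ _

theorem switchTo_self (σ : N → List A → A → ℝ) (i : N) (I : Finset (List A)) (a : A) :
    switchTo σ i I a i = fun h b => if h ∈ I then (if b = a then 1 else 0) else σ i h b :=
  Function.update_self _ _ _

theorem switchTo_apply_of_mem (σ : N → List A → A → ℝ) (i : N) {I : Finset (List A)} {h : List A}
    (hh : h ∈ I) (a b : A) : switchTo σ i I a i h b = if b = a then 1 else 0 := by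
  rw [switchTo_self]
  exact if_pos hh

end Steps

variable {N A : Type*} [Fintype N] [DecidableEq N] [Fintype A] [DecidableEq A] {G : GameTree N A}

/-! ### Products along a path -/

theorem pathProd_self (f : List A → A → ℝ) (o : Option N) (h : List A) :
    G.pathProd f o h h = 1 := by
  simp [pathProd, steps_self]

theorem pathProd_concat (f : List A → A → ℝ) (o : Option N) {h z : List A} (hz : h <+: z) (a : A) :
    G.pathProd f o h (z ++ [a]) = G.pathProd f o h z * if G.player z = o then f z a else 1 := by
  rw [pathProd, pathProd, steps_concat hz]
  split_ifs with ho <;> simp [ho]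

theorem pathProd_mul (f : List A → A → ℝ) (o : Option N) {h g z : List A} (hg : h <+: g)
    (hz : g <+: z) : G.pathProd f o h g * G.pathProd f o g z = G.pathProd f o h z := by
  simp [pathProd, steps_append hg hz]

theorem pathProd_cons (f : List A → A → ℝ) (o : Option N) {h z : List A} {a : A}
    (hz : h ++ [a] <+: z) :
    G.pathProd f o h z = (if G.player h = o then f h a else 1) * G.pathProd f o (h ++ [a]) z := by
  rw [← pathProd_mul f o (List.prefix_append h [a]) hz, pathProd_concat f o List.prefix_rfl,
    pathProd_self, one_mul]

theorem pathProd_congr {f f' : List A → A → ℝ} {o : Option N} {h z : List A}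
    (hf : ∀ g a, h <+: g → g ++ [a] <+: z → G.player g = o → f g a = f' g a) :
    G.pathProd f o h z = G.pathProd f' o h z := by
  unfold pathProd
  congr 1
  refine List.map_congr_left fun p hp => ?_
  rw [List.mem_filter, decide_eq_true_eq] at hp
  exact hf _ _ (prefix_of_mem_steps hp.1).1 (prefix_of_mem_steps hp.1).2 hp.2

theorem pathProd_nonneg {f : List A → A → ℝ} {o : Option N} {h z : List A}
    (hf : ∀ g a, g ++ [a] <+: z → G.player g = o → 0 ≤ f g a) : 0 ≤ G.pathProd f o h z := by
  refine List.prod_nonneg fun x hx => ?_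
  rw [List.mem_map] at hx
  obtain ⟨p, hp, rfl⟩ := hx
  rw [List.mem_filter, decide_eq_true_eq] at hp
  exact hf _ _ (prefix_of_mem_steps hp.1).2 hp.2

/-! ### Reach probabilities -/

theorem reach_self (σ : N → List A → A → ℝ) (h : List A) : G.reach σ h h = 1 := by
  simp [reach, pathProd_self]

theorem reach_mul (σ : N → List A → A → ℝ) {h g z : List A} (hg : h <+: g) (hz : g <+: z) :
    G.reach σ h g * G.reach σ g z = G.reach σ h z := by
  simp only [reach, ← Finset.prod_mul_distrib, pathProd_mul _ _ hg hz]

theorem reach_cons (σ : N → List A → A → ℝ) {h z : List A} {a : A} (hz : h ++ [a] <+: z) :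
    G.reach σ h z = G.behaviour σ (G.player h) h a * G.reach σ (h ++ [a]) z := by
  simp only [reach, pathProd_cons _ _ hz, Finset.prod_mul_distrib]
  simp

theorem reachOthers_mul_pathProd (σ : N → List A → A → ℝ) (i : N) (h : List A) :
    G.reachOthers σ i h * G.pathProd (σ i) (some i) [] h = G.reach σ [] h :=
  Finset.prod_erase_mul _ (fun o => G.pathProd (G.behaviour σ o) o [] h) (Finset.mem_univ (some i))

/-- Moves the split point of the others' contribution from `h` to `z`, after which only player `i`'s
own factor depends on `h`. -/
theorem reachOthers_mul_reach (σ : N → List A → A → ℝ) (i : N) {h z : List A} (hz : h <+: z) :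
    G.reachOthers σ i h * G.reach σ h z =
      G.reachOthers σ i z * G.pathProd (σ i) (some i) h z := by
  rw [reach, ← Finset.prod_erase_mul _ _ (Finset.mem_univ (some i)), reachOthers, reachOthers,
    ← mul_assoc, ← Finset.prod_mul_distrib]
  simp only [pathProd_mul _ _ List.nil_prefix hz]
  rfl

theorem reachOthers_congr {σ τ : N → List A → A → ℝ} {i : N} (hστ : ∀ j ≠ i, σ j = τ j)
    (h : List A) : G.reachOthers σ i h = G.reachOthers τ i h := by
  refine Finset.prod_congr rfl fun o ho => ?_
  cases o with
  | none => rfl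
  | some j =>
    have : j ≠ i := fun hj => (Finset.ne_of_mem_erase ho) (by rw [hj])
    simp [behaviour, hστ j this]

/-- The probabilities of the profile are nonnegative and sum up to one. -/
def IsProfile (G : GameTree N A) (σ : N → List A → A → ℝ) : Prop :=
  ∀ j, ∀ h ∈ G.playerHist j, (∀ a, 0 ≤ σ j h a) ∧ ∑ a ∈ G.acts h, σ j h a = 1

/-! ### Terminal histories, available actions and total probability -/

theorem mem_acts {h : List A} {a : A} : a ∈ G.acts h ↔ h ++ [a] ∈ G.hist := by
  simp [acts]

theorem mem_hist_of_mem_terminal {z : List A} (hz : z ∈ G.terminal) : z ∈ G.hist :=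
  (Finset.mem_filter.1 hz).1

theorem eq_of_mem_terminal {z h : List A} (hz : z ∈ G.terminal) (hh : h ∈ G.hist) (hzh : z <+: h) :
    h = z :=
  (Finset.mem_filter.1 hz).2 h hh hzh

theorem exists_acts_of_notMem_terminal {h : List A} (hh : h ∈ G.hist) (ht : h ∉ G.terminal) :
    ∃ a, h ++ [a] ∈ G.hist := by
  simp only [terminal, Finset.mem_filter, hh, true_and, not_forall] at ht
  obtain ⟨h', hh', hp, hne⟩ := ht
  obtain ⟨a, ha⟩ := exists_concat_prefix hp hne
  exact ⟨a, G.prefix_mem _ _ hh' ha⟩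

theorem notMem_terminal_of_concat {h : List A} {a : A} (ha : h ++ [a] ∈ G.hist) :
    h ∉ G.terminal := fun ht => by
  simpa using eq_of_mem_terminal ht ha (List.prefix_append _ _)

theorem mem_playerHist_of_concat {h : List A} {a : A} {j : N} (ha : h ++ [a] ∈ G.hist)
    (hj : G.player h = some j) : h ∈ G.playerHist j :=
  Finset.mem_filter.2 ⟨G.prefix_mem _ _ ha (List.prefix_append _ _),
    notMem_terminal_of_concat ha, hj⟩

theorem IsProfile.behaviour_nonneg {σ : N → List A → A → ℝ} (hσ : G.IsProfile σ) {h : List A}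
    {a : A} (ha : h ++ [a] ∈ G.hist) : 0 ≤ G.behaviour σ (G.player h) h a := by
  cases hp : G.player h with
  | none => exact G.chance_nonneg h a ha hp
  | some j => exact (hσ j h (mem_playerHist_of_concat ha hp)).1 a

theorem IsProfile.behaviour_sum {σ : N → List A → A → ℝ} (hσ : G.IsProfile σ) {h : List A}
    (hh : h ∈ G.hist) (ht : h ∉ G.terminal) :
    ∑ a ∈ G.acts h, G.behaviour σ (G.player h) h a = 1 := by
  cases hp : G.player h with
  | none => exact G.chance_sum h hh (exists_acts_of_notMem_terminal hh ht) hp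
  | some j => exact (hσ j h (Finset.mem_filter.2 ⟨hh, ht, hp⟩)).2

theorem IsProfile.reach_nonneg {σ : N → List A → A → ℝ} (hσ : G.IsProfile σ) {h z : List A}
    (hz : z ∈ G.hist) : 0 ≤ G.reach σ h z :=
  Finset.prod_nonneg fun _ _ => pathProd_nonneg fun _ _ hg ho =>
    ho ▸ hσ.behaviour_nonneg (G.prefix_mem _ _ hz hg)

theorem IsProfile.reachOthers_nonneg {σ : N → List A → A → ℝ} (hσ : G.IsProfile σ) (i : N)
    {z : List A} (hz : z ∈ G.hist) : 0 ≤ G.reachOthers σ i z :=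
  Finset.prod_nonneg fun _ _ => pathProd_nonneg fun _ _ hg ho =>
    ho ▸ hσ.behaviour_nonneg (G.prefix_mem _ _ hz hg)

theorem IsProfile.sum_reach {σ : N → List A → A → ℝ} (hσ : G.IsProfile σ) {h : List A}
    (hh : h ∈ G.hist) : ∑ z ∈ G.terminal with h <+: z, G.reach σ h z = 1 := by
  -- Induction on the room left below `h`: the longest history bounds the depth, and each action
  -- uses up one unit.
  obtain ⟨n, hn⟩ : ∃ n, n = G.hist.sup List.length - h.length := ⟨_, rfl⟩
  induction n using Nat.strong_induction_on generalizing h with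
  | _ n ih =>
    by_cases ht : h ∈ G.terminal
    · rw [Finset.sum_eq_single_of_mem h (by simp [ht]), reach_self]
      intro z hz hne
      rw [Finset.mem_filter] at hz
      exact absurd (eq_of_mem_terminal ht (mem_hist_of_mem_terminal hz.1) hz.2) hne
    · have hsplit : {z ∈ G.terminal | h <+: z} =
          (G.acts h).biUnion fun a => {z ∈ G.terminal | h ++ [a] <+: z} := by
        ext z
        simp only [Finset.mem_filter, Finset.mem_biUnion, mem_acts]
        constructor
        · rintro ⟨hz, hp⟩
          obtain ⟨a, ha⟩ := exists_concat_prefix hp (fun e => ht (e ▸ hz))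
          exact ⟨a, G.prefix_mem _ _ (mem_hist_of_mem_terminal hz) ha, hz, ha⟩
        · rintro ⟨a, -, hz, ha⟩
          exact ⟨hz, (List.prefix_append _ _).trans ha⟩
      rw [hsplit, Finset.sum_biUnion, ← hσ.behaviour_sum hh ht]
      · refine Finset.sum_congr rfl fun a ha => ?_
        rw [mem_acts] at ha
        have hlen := Finset.le_sup (f := List.length) ha
        rw [List.length_append, List.length_singleton] at hlen
        rw [← mul_one (G.behaviour σ (G.player h) h a),
          ← ih (G.hist.sup List.length - (h ++ [a]).length) (by simp; omega) ha rfl, Finset.mul_sum]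
        exact Finset.sum_congr rfl fun z hz => reach_cons σ (Finset.mem_filter.1 hz).2
      · intro a _ b _ hab
        rw [Function.onFun, Finset.disjoint_left]
        intro z hz hz'
        exact hab (concat_prefix_unique (Finset.mem_filter.1 hz).2 (Finset.mem_filter.1 hz').2)

end GameTree

namespace GameTree

variable {N A : Type*} [Fintype N] [DecidableEq N] [Fintype A] [DecidableEq A] {G : GameTree N A}

/-! ### Sums over incomparable histories -/

theorem sum_through {J : Finset (List A)} (hJ : ∀ h ∈ J, ∀ h' ∈ J, h <+: h' → h = h')
    (f : List A → List A → ℝ) :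
    ∑ z ∈ G.through J, f (prefixIn J z) z = ∑ h ∈ J, ∑ z ∈ G.terminal with h <+: z, f h z := by
  simp only [through, Finset.sum_filter]
  rw [Finset.sum_comm]
  exact Finset.sum_congr rfl fun z _ => (sum_prefixes hJ (fun h => f h z) z).symm

/-- Incomparable histories have disjoint sets of terminal extensions, so the left side is the
probability of part of `Z`. -/
theorem IsProfile.sum_reach_le_one {σ : N → List A → A → ℝ} (hσ : G.IsProfile σ)
    {J : Finset (List A)} (hJ : ∀ h ∈ J, ∀ h' ∈ J, h <+: h' → h = h') (hh : J ⊆ G.hist) :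
    ∑ h ∈ J, G.reach σ [] h ≤ 1 := by
  calc ∑ h ∈ J, G.reach σ [] h
      = ∑ h ∈ J, ∑ z ∈ G.terminal with h <+: z, G.reach σ [] z := by
        refine Finset.sum_congr rfl fun h hJh => ?_
        rw [← mul_one (G.reach σ [] h), ← hσ.sum_reach (hh hJh), Finset.mul_sum]
        exact Finset.sum_congr rfl fun z hz =>
          reach_mul σ List.nil_prefix (Finset.mem_filter.1 hz).2
    _ = ∑ z ∈ G.through J, G.reach σ [] z := (sum_through hJ fun _ z => G.reach σ [] z).symm
    _ ≤ ∑ z ∈ G.terminal with [] <+: z, G.reach σ [] z := by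
        refine Finset.sum_le_sum_of_subset_of_nonneg (fun z hz => ?_) fun z hz _ => ?_
        · exact Finset.mem_filter.2 ⟨(Finset.mem_filter.1 hz).1, List.nil_prefix⟩
        · exact hσ.reach_nonneg (mem_hist_of_mem_terminal (Finset.mem_filter.1 hz).1)
    _ = 1 := hσ.sum_reach G.nil_mem

/-! ### Value differences and the range of utilities -/

theorem utility_sub_le_range (G : GameTree N A) (i : N) {z z' : List A} (hz : z ∈ G.terminal)
    (hz' : z' ∈ G.terminal) : G.utility i z - G.utility i z' ≤ G.range i :=
  le_ciSup (f := fun p : ↥(G.terminal ×ˢ G.terminal) => G.utility i p.1.1 - G.utility i p.1.2)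
    (Set.finite_range _).bddAbove ⟨(z, z'), Finset.mk_mem_product hz hz'⟩

theorem range_nonneg (G : GameTree N A) (i : N) : 0 ≤ G.range i := by
  rcases G.terminal.eq_empty_or_nonempty with h | ⟨z, hz⟩
  · have : IsEmpty ↥(G.terminal ×ˢ G.terminal) := ⟨fun p => by simpa [h] using p.2⟩
    -- A real supremum over an empty family is 0 by convention.
    rw [range, Real.iSup_of_isEmpty]
  · simpa using utility_sub_le_range G i hz hz

/-- The difference of two expectations is the average of `u z - u z'` over independent `z` and `z'`.
-/
theorem sum_mul_sub_sum_mul_le {ι : Type*} {s : Finset ι} {p q u : ι → ℝ} {d : ℝ}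
    (hp : ∀ z ∈ s, 0 ≤ p z) (hq : ∀ z ∈ s, 0 ≤ q z) (hp1 : ∑ z ∈ s, p z = 1)
    (hq1 : ∑ z ∈ s, q z = 1) (hu : ∀ z ∈ s, ∀ z' ∈ s, u z - u z' ≤ d) :
    ∑ z ∈ s, u z * p z - ∑ z ∈ s, u z * q z ≤ d := by
  have hle : ∀ z ∈ s, u z - ∑ z' ∈ s, u z' * q z' ≤ d := fun z hz => by
    calc u z - ∑ z' ∈ s, u z' * q z' = ∑ z' ∈ s, (u z - u z') * q z' := by
          simp only [sub_mul, Finset.sum_sub_distrib, ← Finset.mul_sum, hq1, mul_one]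
      _ ≤ ∑ z' ∈ s, d * q z' := Finset.sum_le_sum fun z' hz' =>
          mul_le_mul_of_nonneg_right (hu z hz z' hz') (hq z' hz')
      _ = d := by rw [← Finset.mul_sum, hq1, mul_one]
  calc ∑ z ∈ s, u z * p z - ∑ z ∈ s, u z * q z
      = ∑ z ∈ s, (u z - ∑ z' ∈ s, u z' * q z') * p z := by
        simp only [sub_mul, Finset.sum_sub_distrib, ← Finset.mul_sum, hp1, mul_one]
    _ ≤ ∑ z ∈ s, d * p z := Finset.sum_le_sum fun z hz =>
        mul_le_mul_of_nonneg_right (hle z hz) (hp z hz)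
    _ = d := by rw [← Finset.mul_sum, hp1, mul_one]

/-- The others weight each `h ∈ J` equally under both profiles; below `h` two expectations of the
same utility are compared. -/
theorem cfValue_sub_le {σ τ : N → List A → A → ℝ} {i : N} (hσ : G.IsProfile σ)
    (hτ : G.IsProfile τ) (hστ : ∀ j ≠ i, σ j = τ j) {J : Finset (List A)}
    (hJ : ∀ h ∈ J, ∀ h' ∈ J, h <+: h' → h = h') (hh : J ⊆ G.hist) :
    G.cfValue i σ J - G.cfValue i τ J ≤ G.range i * ∑ h ∈ J, G.reachOthers σ i h := by
  rw [cfValue, cfValue, sum_through hJ fun h z =>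
      G.utility i z * G.reachOthers σ i h * G.reach σ h z, sum_through hJ fun h z =>
      G.utility i z * G.reachOthers τ i h * G.reach τ h z, ← Finset.sum_sub_distrib, Finset.mul_sum]
  refine Finset.sum_le_sum fun h hhJ => ?_
  have hle := sum_mul_sub_sum_mul_le (s := {z ∈ G.terminal | h <+: z}) (p := G.reach σ h)
    (q := G.reach τ h) (u := G.utility i) (d := G.range i)
    (fun z hz => hσ.reach_nonneg (mem_hist_of_mem_terminal (Finset.mem_filter.1 hz).1))
    (fun z hz => hτ.reach_nonneg (mem_hist_of_mem_terminal (Finset.mem_filter.1 hz).1))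
    (hσ.sum_reach (hh hhJ)) (hτ.sum_reach (hh hhJ))
    (fun z hz z' hz' => utility_sub_le_range G i (Finset.mem_filter.1 hz).1
      (Finset.mem_filter.1 hz').1)
  have := mul_le_mul_of_nonneg_right hle (hσ.reachOthers_nonneg i (hh hhJ))
  rw [sub_mul, Finset.sum_mul, Finset.sum_mul] at this
  rw [← reachOthers_congr hστ]
  refine le_of_eq_of_le (congrArg₂ _ ?_ ?_) this <;>
    exact Finset.sum_congr rfl fun z _ => by ring

/-! ### The value of an action and the decomposition of regret -/

/-- The contribution of player `i`, following `f`, to reaching `z` from `h a`; zero if `z` does not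
extend `h a`. -/
def tailProd (G : GameTree N A) (f : List A → A → ℝ) (i : N) (h : List A) (a : A) (z : List A) :
    ℝ :=
  if h ++ [a] <+: z then G.pathProd f (some i) (h ++ [a]) z else 0

/-- The extra summand is the case where `z ++ [b]` is `h ++ [a]` itself, which `tailProd` at `z`
does not yet see. -/
theorem tailProd_concat (f : List A → A → ℝ) (i : N) (h z : List A) (a b : A) :
    G.tailProd f i h a (z ++ [b]) =
      G.tailProd f i h a z * (if G.player z = some i then f z b else 1) +
        if h = z then (if a = b then 1 else 0) else 0 := by
  unfold tailProd
  by_cases hz : h ++ [a] <+: z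
  · have hne : h ≠ z := fun e => by simpa [e] using hz.length_le
    rw [if_pos hz, if_pos (hz.trans (List.prefix_append _ _)), if_neg hne, pathProd_concat _ _ hz,
      add_zero]
  · rw [if_neg hz, zero_mul, zero_add]
    simp only [List.prefix_concat_iff, hz, or_false]
    by_cases hb : h = z
    · subst hb
      by_cases hab : a = b
      · subst hab
        simp [pathProd_self]
      · simp [hab]
    · simp [hb]

/-- Telescoping: `f` before `h`, the difference at `h`, `g` after it. Histories off the path to `z`
contribute nothing because `tailProd` vanishes. -/
theorem pathProd_sub_pathProd (f g : List A → A → ℝ) (i : N) {z : List A} (hz : z ∈ G.hist) :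
    G.pathProd f (some i) [] z - G.pathProd g (some i) [] z =
      ∑ h ∈ G.playerHist i, G.pathProd f (some i) [] h *
        ∑ a ∈ G.acts h, (f h a - g h a) * G.tailProd g i h a z := by
  induction z using List.reverseRecOn with
  | nil => simp [pathProd_self, tailProd]
  | append_singleton z b ih =>
    specialize ih (G.prefix_mem _ _ hz (List.prefix_append _ _))
    have hlast : (∑ h ∈ G.playerHist i, G.pathProd f (some i) [] h *
        ∑ a ∈ G.acts h, (f h a - g h a) * if h = z then (if a = b then 1 else 0) else 0) =
        if G.player z = some i then G.pathProd f (some i) [] z * (f z b - g z b) else 0 := by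
      split_ifs with hp
      · rw [Finset.sum_eq_single_of_mem z (mem_playerHist_of_concat hz hp)]
        · simp [mem_acts, hz]
        · intro h _ hne
          simp [hne]
      · refine Finset.sum_eq_zero fun h hh => ?_
        have hne : h ≠ z := fun e => hp (e ▸ (Finset.mem_filter.1 hh).2.2)
        simp [hne]
    simp only [tailProd_concat, mul_add, Finset.sum_add_distrib, hlast]
    simp only [← mul_assoc, ← Finset.sum_mul]
    rw [← ih, pathProd_concat _ _ List.nil_prefix, pathProd_concat _ _ List.nil_prefix]
    split_ifs <;> ring

/-- The counterfactual value of taking action `a` at the history `h` of player `i`. -/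
def actionValue (G : GameTree N A) (i : N) (σ : N → List A → A → ℝ) (h : List A) (a : A) : ℝ :=
  ∑ z ∈ G.terminal, G.utility i z * G.reachOthers σ i z * G.tailProd (σ i) i h a z

theorem expectedUtility_eq (G : GameTree N A) (i : N) (σ : N → List A → A → ℝ) :
    G.expectedUtility i σ =
      ∑ z ∈ G.terminal, G.utility i z * G.reachOthers σ i z * G.pathProd (σ i) (some i) [] z := by
  simp only [expectedUtility, ← reachOthers_mul_pathProd σ i, mul_assoc]

/-- The deviation supplies the weight of reaching `h`, while the continuation values come from the
profile actually played. Hence the values are those on which CFR is run, and only `s` has to be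
measured against perfect recall. -/
theorem expectedUtility_update_sub (G : GameTree N A) (i : N) (σ : N → List A → A → ℝ)
    (s : List A → A → ℝ) :
    G.expectedUtility i (Function.update σ i s) - G.expectedUtility i σ =
      ∑ h ∈ G.playerHist i, G.pathProd s (some i) [] h *
        ∑ a ∈ G.acts h, (s h a - σ i h a) * G.actionValue i σ h a := by
  have hO : ∀ z, G.reachOthers (Function.update σ i s) i z = G.reachOthers σ i z :=
    reachOthers_congr fun j hj => Function.update_of_ne hj _ _
  simp only [expectedUtility_eq, hO, Function.update_self, ← Finset.sum_sub_distrib, ← mul_sub]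
  calc _ = ∑ z ∈ G.terminal, ∑ h ∈ G.playerHist i, ∑ a ∈ G.acts h,
        G.pathProd s (some i) [] h * ((s h a - σ i h a) *
          (G.utility i z * G.reachOthers σ i z * G.tailProd (σ i) i h a z)) := by
        refine Finset.sum_congr rfl fun z hz => ?_
        rw [pathProd_sub_pathProd _ _ _ (mem_hist_of_mem_terminal hz), Finset.mul_sum]
        refine Finset.sum_congr rfl fun h _ => ?_
        rw [Finset.mul_sum, Finset.mul_sum]
        exact Finset.sum_congr rfl fun a _ => by ring
    _ = _ := by
        rw [Finset.sum_comm]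
        refine Finset.sum_congr rfl fun h _ => ?_
        rw [Finset.sum_comm, Finset.mul_sum]
        refine Finset.sum_congr rfl fun a _ => ?_
        rw [actionValue, Finset.mul_sum, Finset.mul_sum]

theorem pathProd_eq_sum_tailProd (f : List A → A → ℝ) (i : N) {h z : List A}
    (hh : h ∈ G.playerHist i) (hz : z ∈ G.terminal) :
    (if h <+: z then G.pathProd f (some i) h z else 0) =
      ∑ a ∈ G.acts h, f h a * G.tailProd f i h a z := by
  split_ifs with hp
  · obtain ⟨-, ht, hi⟩ := Finset.mem_filter.1 hh
    obtain ⟨a, ha⟩ := exists_concat_prefix hp (fun e => ht (e ▸ hz))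
    rw [Finset.sum_eq_single_of_mem a
      (mem_acts.2 (G.prefix_mem _ _ (mem_hist_of_mem_terminal hz) ha)), tailProd, if_pos ha,
      pathProd_cons _ _ ha, if_pos hi]
    intro b _ hb
    rw [tailProd, if_neg fun hb' => hb (concat_prefix_unique hb' ha), mul_zero]
  · refine (Finset.sum_eq_zero fun a _ => ?_).symm
    rw [tailProd, if_neg fun ha => hp ((List.prefix_append _ _).trans ha), mul_zero]

theorem cfValue_eq_sum_reachOthers (i : N) (σ : N → List A → A → ℝ) {J : Finset (List A)}
    (hJ : ∀ h ∈ J, ∀ h' ∈ J, h <+: h' → h = h') :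
    G.cfValue i σ J = ∑ h ∈ J, ∑ z ∈ G.terminal with h <+: z,
      G.utility i z * G.reachOthers σ i z * G.pathProd (σ i) (some i) h z := by
  rw [cfValue, sum_through hJ fun h z => G.utility i z * G.reachOthers σ i h * G.reach σ h z]
  refine Finset.sum_congr rfl fun h _ => Finset.sum_congr rfl fun z hz => ?_
  rw [mul_assoc, reachOthers_mul_reach σ i (Finset.mem_filter.1 hz).2, mul_assoc]

theorem cfValue_eq_sum_actionValue (i : N) (σ : N → List A → A → ℝ) {J : Finset (List A)}
    (hJ : ∀ h ∈ J, ∀ h' ∈ J, h <+: h' → h = h') (hi : J ⊆ G.playerHist i) :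
    G.cfValue i σ J = ∑ h ∈ J, ∑ a ∈ G.acts h, σ i h a * G.actionValue i σ h a := by
  rw [cfValue_eq_sum_reachOthers i σ hJ]
  refine Finset.sum_congr rfl fun h hh => ?_
  simp only [actionValue, Finset.mul_sum]
  rw [Finset.sum_comm, Finset.sum_filter]
  refine Finset.sum_congr rfl fun z hz => ?_
  rw [← mul_ite_zero, pathProd_eq_sum_tailProd _ _ (hi hh) hz, Finset.mul_sum]
  exact Finset.sum_congr rfl fun a _ => by ring

theorem cfValue_switchTo (i : N) (σ : N → List A → A → ℝ) {I J : Finset (List A)}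
    (hI : ∀ h ∈ I, ∀ h' ∈ I, h <+: h' → h = h') (hi : I ⊆ G.playerHist i) (hJI : J ⊆ I) {a : A}
    (ha : ∀ h ∈ J, a ∈ G.acts h) :
    G.cfValue i (switchTo σ i I a) J = ∑ h ∈ J, G.actionValue i σ h a := by
  rw [cfValue_eq_sum_actionValue i _ (fun h hh h' hh' => hI h (hJI hh) h' (hJI hh'))
    (hJI.trans hi)]
  refine Finset.sum_congr rfl fun h hh => ?_
  rw [Finset.sum_eq_single_of_mem a (ha h hh)]
  · rw [switchTo_apply_of_mem _ _ (hJI hh), if_pos rfl, one_mul]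
    refine Finset.sum_congr rfl fun z _ => ?_
    rw [reachOthers_congr (fun j hj => switchTo_of_ne σ hj I a)]
    congr 1
    rw [switchTo_self]
    unfold tailProd
    split_ifs with hz
    · refine pathProd_congr fun g b hg _ _ => if_neg fun hgI => ?_
      have := hI h (hJI hh) g hgI ((List.prefix_append _ _).trans hg)
      subst this
      simpa using hg.length_le
    · rfl
  · intro b _ hb
    rw [switchTo_apply_of_mem _ _ (hJI hh), if_neg hb, zero_mul]

theorem IsProfile.switchTo {σ : N → List A → A → ℝ} (hσ : G.IsProfile σ) {i : N}
    {I : Finset (List A)} {a : A} (ha : ∀ h ∈ I, a ∈ G.acts h) :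
    G.IsProfile (switchTo σ i I a) := by
  intro j h hh
  by_cases hj : j = i
  · subst hj
    rw [switchTo_self]
    by_cases hI : h ∈ I
    · simp only [hI, if_true]
      exact ⟨fun b => by split_ifs <;> norm_num, by simp [ha h hI]⟩
    · simp only [hI, if_false]
      exact hσ j h hh
  · rw [switchTo_of_ne σ hj]
    exact hσ j h hh

end GameTree

/-! ### Regret matching -/

/-- Growth of the potential in one round; the cross term is the one that regret matching
annihilates. -/
theorem sq_posPart_add_le (x y : ℝ) :
    max (x + y) 0 ^ 2 ≤ max x 0 ^ 2 + 2 * (max x 0 * y) + y ^ 2 := by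
  rcases le_total x 0 with hx | hx <;> rcases le_total (x + y) 0 with hxy | hxy <;>
    simp only [max_eq_left, max_eq_right, hx, hxy] <;> nlinarith

theorem sum_sq_posPart_le {ι : Type*} (s : Finset ι) (r : ℕ → ι → ℝ) (D : ℝ)
    (hr : ∀ t ≥ 1, ∀ a ∈ s, |r t a| ≤ D)
    (horth : ∀ T, ∑ a ∈ s, max (∑ t ∈ Finset.Icc 1 T, r t a) 0 * r (T + 1) a = 0) (T : ℕ) :
    ∑ a ∈ s, max (∑ t ∈ Finset.Icc 1 T, r t a) 0 ^ 2 ≤ D ^ 2 * s.card * T := by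
  induction T with
  | zero => simp
  | succ T ih =>
    simp only [Finset.sum_Icc_succ_top (Nat.le_add_left 1 T)]
    calc _ ≤ ∑ a ∈ s, (max (∑ t ∈ Finset.Icc 1 T, r t a) 0 ^ 2 +
          2 * (max (∑ t ∈ Finset.Icc 1 T, r t a) 0 * r (T + 1) a) + r (T + 1) a ^ 2) :=
          Finset.sum_le_sum fun a _ => sq_posPart_add_le _ _
      _ ≤ D ^ 2 * s.card * T + 2 * 0 + ∑ _a ∈ s, D ^ 2 := by
          rw [Finset.sum_add_distrib, Finset.sum_add_distrib, ← Finset.mul_sum, horth]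
          refine add_le_add (add_le_add_left ih _) (Finset.sum_le_sum fun a ha => ?_)
          exact sq_le_sq.2 ((hr _ (Nat.le_add_left 1 T) a ha).trans (le_abs_self D))
      _ = D ^ 2 * s.card * (T + 1 : ℕ) := by
          rw [Finset.sum_const, nsmul_eq_mul]
          push_cast
          ring

theorem posPart_le_of_orthogonal {ι : Type*} (s : Finset ι) (r : ℕ → ι → ℝ) {D : ℝ} (hD : 0 ≤ D)
    (hr : ∀ t ≥ 1, ∀ a ∈ s, |r t a| ≤ D)
    (horth : ∀ T, ∑ a ∈ s, max (∑ t ∈ Finset.Icc 1 T, r t a) 0 * r (T + 1) a = 0) (T : ℕ) {a : ι}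
    (ha : a ∈ s) : ∑ t ∈ Finset.Icc 1 T, r t a ≤ D * √s.card * √T := by
  refine (le_max_left _ 0).trans (le_of_sq_le_sq ?_ (by positivity))
  rw [mul_pow, mul_pow, Real.sq_sqrt (by positivity), Real.sq_sqrt (by positivity)]
  exact (Finset.single_le_sum (f := fun a => max (∑ t ∈ Finset.Icc 1 T, r t a) 0 ^ 2)
    (fun _ _ => sq_nonneg _) ha).trans (sum_sq_posPart_le s r D hr horth T)

/-- Regret matching on the sum of several proportional regrets bounds their weighted sum. -/
theorem weighted_regret_le {ι κ : Type*} (P : Finset κ) (s : Finset ι) (r : κ → ℕ → ι → ℝ)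
    (w c : κ → ℝ) (p : κ → ι → ℝ) {D M : ℝ} (hD : 0 ≤ D) {j₀ : κ} (hj₀ : j₀ ∈ P)
    (hw : ∀ j ∈ P, 0 ≤ w j) (hc : ∀ j ∈ P, 0 ≤ c j) (hcM : ∀ j ∈ P, c j ≤ M)
    (hp : ∀ j ∈ P, ∀ a, 0 ≤ p j a) (hp1 : ∀ j ∈ P, ∑ a ∈ s, p j a = 1)
    (hr : ∀ j ∈ P, ∀ t ≥ 1, ∀ a ∈ s, r j t a = c j * r j₀ t a)
    (hbound : ∀ t ≥ 1, ∀ a ∈ s, ∑ j ∈ P, w j * |r j t a| ≤ D)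
    (horth : ∀ T, ∑ a ∈ s, max (∑ t ∈ Finset.Icc 1 T, ∑ j ∈ P, r j t a) 0 * r j₀ (T + 1) a = 0)
    (T : ℕ) :
    ∑ j ∈ P, w j * ∑ a ∈ s, p j a * ∑ t ∈ Finset.Icc 1 T, r j t a ≤ D * M * √s.card * √T := by
  set R : ℕ → ι → ℝ := fun T a => ∑ t ∈ Finset.Icc 1 T, r j₀ t a with hR
  have hsum : ∀ j ∈ P, ∀ a ∈ s, ∀ T, ∑ t ∈ Finset.Icc 1 T, r j t a = c j * R T a := by
    intro j hj a ha T
    rw [hR, Finset.mul_sum]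
    exact Finset.sum_congr rfl fun t ht => hr j hj t (Finset.mem_Icc.1 ht).1 a ha
  have hlhs : ∑ j ∈ P, w j * ∑ a ∈ s, p j a * ∑ t ∈ Finset.Icc 1 T, r j t a =
      ∑ j ∈ P, w j * c j * ∑ a ∈ s, p j a * R T a := by
    refine Finset.sum_congr rfl fun j hj => ?_
    rw [mul_assoc, Finset.mul_sum (a := c j)]
    congr 1
    refine Finset.sum_congr rfl fun a ha => ?_
    rw [hsum j hj a ha]
    ring
  have hM : 0 ≤ M := (hc j₀ hj₀).trans (hcM j₀ hj₀)
  rw [hlhs]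
  -- Proportionality of `r j₀` to itself leaves two cases: the constant is one, or `r j₀`, and with
  -- it every regret, vanishes.
  by_cases hc1 : c j₀ = 1
  · set B := ∑ j ∈ P, w j * c j with hB
    set C := ∑ j ∈ P, c j
    have hwc : ∀ j ∈ P, 0 ≤ w j * c j := fun j hj => mul_nonneg (hw j hj) (hc j hj)
    have hB0 : 0 ≤ B := Finset.sum_nonneg hwc
    have hC0 : 0 < C := by
      have := Finset.single_le_sum hc hj₀
      rw [hc1] at this
      exact one_pos.trans_le this
    -- The total regret is `C * R` with `C > 0`, and positive parts commute with `C`, so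
    -- orthogonality to the total regret passes to `R`.
    have horth' : ∀ T, ∑ a ∈ s, max (R T a) 0 * r j₀ (T + 1) a = 0 := by
      intro T
      have h := horth T
      have : ∀ a ∈ s, max (∑ t ∈ Finset.Icc 1 T, ∑ j ∈ P, r j t a) 0 * r j₀ (T + 1) a =
          C * (max (R T a) 0 * r j₀ (T + 1) a) := by
        intro a ha
        rw [Finset.sum_comm, Finset.sum_congr rfl fun j hj => hsum j hj a ha T, ← Finset.sum_mul,
          ← mul_assoc, mul_max_of_nonneg _ _ hC0.le, mul_zero]
      rw [Finset.sum_congr rfl this, ← Finset.mul_sum] at h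
      exact (mul_eq_zero.1 h).resolve_left hC0.ne'
    -- Scaling by `B` turns one increment into `∑ j, w j * |r j t a|` in absolute value, which is
    -- exactly what `hbound` controls.
    have hBR : ∀ a ∈ s, B * R T a ≤ D * √s.card * √T := by
      intro a ha
      rw [hR, Finset.mul_sum]
      refine posPart_le_of_orthogonal s (fun t a => B * r j₀ t a) hD ?_ ?_ T ha
      · intro t ht a ha
        rw [abs_mul, abs_of_nonneg hB0, hB, Finset.sum_mul]
        refine (Finset.sum_le_sum fun j hj => ?_).trans (hbound t ht a ha)
        rw [hr j hj t ht a ha, abs_mul, abs_of_nonneg (hc j hj), mul_assoc]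
      · intro T
        have : ∀ a ∈ s, max (∑ t ∈ Finset.Icc 1 T, B * r j₀ t a) 0 * (B * r j₀ (T + 1) a) =
            B ^ 2 * (max (R T a) 0 * r j₀ (T + 1) a) := by
          intro a _
          have hm := mul_max_of_nonneg (R T a) 0 hB0
          rw [mul_zero] at hm
          rw [← Finset.mul_sum, ← hm]
          ring
        rw [Finset.sum_congr rfl this, ← Finset.mul_sum, horth', mul_zero]
    -- The only use of `M`: it is at least `c j₀ = 1`.
    have hDM : D * √s.card * √T ≤ D * M * √s.card * √T := by
      have : 1 ≤ M := hc1 ▸ hcM j₀ hj₀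
      gcongr
      exact le_mul_of_one_le_right hD this
    refine le_trans ?_ hDM
    rcases hB0.eq_or_lt with h0 | hpos
    · rw [Finset.sum_eq_zero fun j hj => ?_]
      · positivity
      · rw [(Finset.sum_eq_zero_iff_of_nonneg hwc).1 h0.symm j hj, zero_mul]
    · calc ∑ j ∈ P, w j * c j * ∑ a ∈ s, p j a * R T a
          ≤ ∑ j ∈ P, w j * c j * (D * √s.card * √T / B) := by
            refine Finset.sum_le_sum fun j hj => mul_le_mul_of_nonneg_left ?_ (hwc j hj)
            calc ∑ a ∈ s, p j a * R T a ≤ ∑ a ∈ s, p j a * (D * √s.card * √T / B) :=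
                  Finset.sum_le_sum fun a ha => mul_le_mul_of_nonneg_left
                    ((le_div_iff₀' hpos).2 (hBR a ha)) (hp j hj a)
              _ = D * √s.card * √T / B := by rw [← Finset.sum_mul, hp1 j hj, one_mul]
        _ = D * √s.card * √T := by
            rw [← Finset.sum_mul, ← hB, mul_div_cancel₀ _ hpos.ne']
  · have hR0 : ∀ a ∈ s, R T a = 0 := by
      intro a ha
      have := hsum j₀ hj₀ a ha T
      have h : (1 - c j₀) * R T a = 0 := by
        rw [sub_mul, one_mul, ← this, sub_self]
      exact (mul_eq_zero.1 h).resolve_left (sub_ne_zero.2 (Ne.symm hc1))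
    rw [Finset.sum_eq_zero fun j _ => ?_]
    · positivity
    · rw [Finset.sum_eq_zero fun a ha => by rw [hR0 a ha, mul_zero], mul_zero]

namespace Info

variable {N A : Type*} [Fintype N] [DecidableEq N] [Fintype A] [DecidableEq A]
  {G : GameTree N A} {Γ Γ' : Info G} {i : N} {I J J' : Finset (List A)}

/-! ### Information sets -/

theorem subset_playerHist (hI : I ∈ (Γ.partition i).parts) : I ⊆ G.playerHist i :=
  (Γ.partition i).subset hI

theorem subset_hist (hI : I ∈ (Γ.partition i).parts) : I ⊆ G.hist :=
  (subset_playerHist hI).trans (Finset.filter_subset _ _)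

theorem infoSet_of_mem_playerHist {h : List A} (hh : h ∈ G.playerHist i) :
    Γ.infoSet h = (Γ.partition i).part h := by
  simp only [infoSet, (Finset.mem_filter.1 hh).2.2]

theorem infoSet_eq (hI : I ∈ (Γ.partition i).parts) {h : List A} (hh : h ∈ I) :
    Γ.infoSet h = I := by
  rw [infoSet_of_mem_playerHist (subset_playerHist hI hh), (Γ.partition i).part_eq_of_mem hI hh]

theorem actsAt_eq (hI : I ∈ (Γ.partition i).parts) {h : List A} (hh : h ∈ I) :
    G.actsAt I = G.acts h := by
  ext a
  simp only [GameTree.actsAt, Finset.mem_biUnion]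
  exact ⟨fun ⟨g, hg, ha⟩ => Γ.acts_eq i I hI g hg h hh ▸ ha, fun ha => ⟨h, hh, ha⟩⟩

theorem sum_playerHist (Γ : Info G) (i : N) (f : List A → ℝ) :
    ∑ h ∈ G.playerHist i, f h = ∑ I ∈ (Γ.partition i).parts, ∑ h ∈ I, f h := by
  conv_lhs => rw [← (Γ.partition i).biUnion_parts]
  exact Finset.sum_biUnion (Γ.partition i).disjoint

/-- `s` is constant on the information sets of player `i`. -/
def IsMeasurable (Γ : Info G) (i : N) (s : List A → A → ℝ) : Prop :=
  ∀ I ∈ (Γ.partition i).parts, ∀ h ∈ I, ∀ h' ∈ I, s h = s h'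

theorem isProfile {σ : N → List A → A → ℝ} (hσ : ∀ j, Γ.IsStrategy j (σ j)) : G.IsProfile σ :=
  fun j h hh => ⟨((hσ j).1 h hh).1, ((hσ j).1 h hh).2.2⟩

theorem IsMeasurable.switchTo {σ : N → List A → A → ℝ} (hσ : ∀ j, Γ.IsMeasurable j (σ j))
    (hI : I ∈ (Γ.partition i).parts) (a : A) (j : N) :
    Γ.IsMeasurable j (GameTree.switchTo σ i I a j) := by
  by_cases hj : j = i
  · subst hj
    intro K hK h hh h' hh'
    by_cases hIK : K = I
    · subst hIK
      ext b
      rw [GameTree.switchTo_apply_of_mem _ _ hh, GameTree.switchTo_apply_of_mem _ _ hh']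
    · have hn : ∀ g ∈ K, g ∉ I := fun g hg hgI =>
        hIK ((Γ.partition j).eq_of_mem_parts hK hI hg hgI)
      simp only [GameTree.switchTo_self, hn h hh, hn h' hh', if_false]
      exact hσ j K hK h hh h' hh'
  · rw [GameTree.switchTo_of_ne σ hj]
    exact hσ j

/-! ### Contributions in terms of information set, action sequences -/

/-- The value of `f` at a chosen history of an information set. -/
noncomputable def setValue (f : List A → A → ℝ) (p : Finset (List A) × A) : ℝ :=
  if hp : p.1.Nonempty then f hp.choose p.2 else 0

theorem setValue_infoSet {f : List A → A → ℝ} {g : List A} (hg : g ∈ G.playerHist i)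
    (hf : ∀ h ∈ Γ.infoSet g, f h = f g) (a : A) : setValue f (Γ.infoSet g, a) = f g a := by
  have hne : (Γ.infoSet g).Nonempty :=
    ⟨g, by rw [infoSet_of_mem_playerHist hg]; exact (Γ.partition i).mem_part hg⟩
  rw [setValue, dif_pos hne, hf _ hne.choose_spec]

theorem infoSet_mem_parts {g : List A} (hg : g ∈ G.playerHist i) :
    Γ.infoSet g ∈ (Γ.partition i).parts := by
  rw [infoSet_of_mem_playerHist hg]
  exact (Γ.partition i).part_mem.2 hg

theorem mem_infoSet {g : List A} (hg : g ∈ G.playerHist i) : g ∈ Γ.infoSet g := by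
  rw [infoSet_of_mem_playerHist hg]
  exact (Γ.partition i).mem_part hg

/-- Player `i`'s contribution depends on the path only through `X_i`; perfect recall and condition
(iv) are both statements about that sequence. -/
theorem pathProd_eq_seqOwn {f : List A → A → ℝ} (hf : Γ.IsMeasurable i f) {h z : List A}
    (hz : z ∈ G.hist) :
    G.pathProd f (some i) h z = ((Γ.seqOwn i h z).map (setValue f)).prod := by
  rw [GameTree.pathProd, seqOwn, List.map_map]
  congr 1
  refine List.map_congr_left fun p hp => ?_
  rw [List.mem_filter, decide_eq_true_eq] at hp
  have hg := GameTree.mem_playerHist_of_concat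
    (G.prefix_mem _ _ hz (GameTree.prefix_of_mem_steps hp.1).2) hp.2
  exact (setValue_infoSet hg (fun h hh =>
    hf _ (infoSet_mem_parts hg) _ hh _ (mem_infoSet hg)) p.2).symm

/-- `X_{-i}` interleaves the moves of several players, so their separate products have to be merged
into one along the path. -/
theorem prod_pathProd (S : Finset (Option N)) (f : Option N → List A → A → ℝ) (h z : List A) :
    ∏ o ∈ S, G.pathProd (f o) o h z =
      (((GameTree.steps h z).filter fun p => G.player p.1 ∈ S).map
        fun p => f (G.player p.1) p.1 p.2).prod := by
  simp only [GameTree.pathProd]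
  induction GameTree.steps h z with
  | nil => simp
  | cons p L ih =>
    have hcons : ∀ o, (((p :: L).filter fun p => G.player p.1 = o).map fun p => f o p.1 p.2).prod =
        (if G.player p.1 = o then f o p.1 p.2 else 1) *
          ((L.filter fun p => G.player p.1 = o).map fun p => f o p.1 p.2).prod := by
      intro o
      by_cases ho : G.player p.1 = o <;> simp [ho]
    simp only [hcons, Finset.prod_mul_distrib, ih]
    by_cases hS : G.player p.1 ∈ S <;> simp [hS]

theorem reachOthers_eq_seqOthers {σ : N → List A → A → ℝ} (hσ : ∀ j, Γ.IsMeasurable j (σ j))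
    (i : N) {z : List A} (hz : z ∈ G.hist) :
    G.reachOthers σ i z = G.reachChance z * ((Γ.seqOthers i z).map
      (setValue fun g a => G.behaviour σ (G.player g) g a)).prod := by
  have hnone : none ∈ Finset.univ.erase (some i) := by simp
  rw [GameTree.reachOthers, ← Finset.mul_prod_erase _ _ hnone, GameTree.reachChance,
    prod_pathProd _ (G.behaviour σ), seqOthers, List.map_map]
  congr 2
  have hfilter : ∀ p : List A × A, (G.player p.1 ∈ (Finset.univ.erase (some i)).erase none) ↔
      (G.player p.1 ≠ none ∧ G.player p.1 ≠ some i) := by simp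
  simp only [hfilter]
  refine List.map_congr_left fun p hp => ?_
  rw [List.mem_filter, decide_eq_true_eq] at hp
  obtain ⟨j, hj⟩ := Option.ne_none_iff_exists'.1 hp.2.1
  have hg := GameTree.mem_playerHist_of_concat
    (G.prefix_mem _ _ hz (GameTree.prefix_of_mem_steps hp.1).2) hj
  refine (setValue_infoSet (Γ := Γ) (f := fun g a => G.behaviour σ (G.player g) g a) hg
    (fun h hh => ?_) p.2).symm
  have hI := infoSet_mem_parts (Γ := Γ) hg
  ext a
  simp only [(Finset.mem_filter.1 (subset_playerHist hI hh)).2.2, hj, GameTree.behaviour]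
  rw [hσ j _ hI _ hh _ (mem_infoSet hg)]

theorem PerfectRecall.pathProd_eq (hΓ : Γ.PerfectRecall) {s : List A → A → ℝ}
    (hs : Γ.IsMeasurable i s) (hI : I ∈ (Γ.partition i).parts) {h h' : List A} (hh : h ∈ I)
    (hh' : h' ∈ I) : G.pathProd s (some i) [] h = G.pathProd s (some i) [] h' := by
  rw [pathProd_eq_seqOwn hs (subset_hist hI hh), pathProd_eq_seqOwn hs (subset_hist hI hh'),
    hΓ i I hI h hh h' hh']

/-! ### Refinements -/

theorem mem_subInfoSets : J ∈ Γ'.subInfoSets i I ↔ J ∈ (Γ'.partition i).parts ∧ J ⊆ I :=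
  Finset.mem_filter

theorem IsAbstractionOf.subset (hΓ : Γ.IsAbstractionOf Γ') (hI : I ∈ (Γ.partition i).parts)
    (hJ : J ∈ (Γ'.partition i).parts) {h : List A} (hhJ : h ∈ J) (hhI : h ∈ I) : J ⊆ I := by
  intro g hg
  have := hΓ i g (subset_playerHist hJ hg) h (subset_playerHist hJ hhJ)
    ((infoSet_eq hJ hg).trans (infoSet_eq hJ hhJ).symm)
  rw [← infoSet_eq hI hhI, ← this]
  exact mem_infoSet (subset_playerHist hJ hg)

theorem IsAbstractionOf.biUnion_subInfoSets (hΓ : Γ.IsAbstractionOf Γ')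
    (hI : I ∈ (Γ.partition i).parts) : (Γ'.subInfoSets i I).biUnion id = I := by
  ext h
  simp only [Finset.mem_biUnion, mem_subInfoSets, id]
  constructor
  · rintro ⟨J, ⟨-, hJ⟩, hh⟩
    exact hJ hh
  · intro hh
    obtain ⟨J, hJ, hhJ⟩ := (Γ'.partition i).exists_mem (subset_playerHist hI hh)
    exact ⟨J, ⟨hJ, hΓ.subset hI hJ hhJ hh⟩, hhJ⟩

theorem IsAbstractionOf.sum_eq (hΓ : Γ.IsAbstractionOf Γ') (hI : I ∈ (Γ.partition i).parts)
    (f : List A → ℝ) : ∑ h ∈ I, f h = ∑ J ∈ Γ'.subInfoSets i I, ∑ h ∈ J, f h := by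
  conv_lhs => rw [← hΓ.biUnion_subInfoSets hI]
  exact Finset.sum_biUnion
    ((Γ'.partition i).disjoint.subset (Finset.coe_subset.2 (Finset.filter_subset _ _)))

theorem IsAbstractionOf.subInfoSets_nonempty (hΓ : Γ.IsAbstractionOf Γ')
    (hI : I ∈ (Γ.partition i).parts) : (Γ'.subInfoSets i I).Nonempty := by
  obtain ⟨h, hh⟩ := (Γ.partition i).nonempty_of_mem_parts hI
  rw [← hΓ.biUnion_subInfoSets hI, Finset.mem_biUnion] at hh
  exact ⟨hh.choose, hh.choose_spec.1⟩

/-! ### Counterfactual values inside an abstract information set -/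

theorem IsAbstractionOf.cfValue_eq_sum (hΓ : Γ.IsAbstractionOf Γ')
    (hI : I ∈ (Γ.partition i).parts) (σ : N → List A → A → ℝ) :
    G.cfValue i σ I = ∑ J ∈ Γ'.subInfoSets i I, G.cfValue i σ J := by
  rw [GameTree.cfValue_eq_sum_reachOthers i σ (Γ.no_repeat i I hI), hΓ.sum_eq hI]
  exact Finset.sum_congr rfl fun J hJ => (GameTree.cfValue_eq_sum_reachOthers i σ
    (Γ'.no_repeat i J (mem_subInfoSets.1 hJ).1)).symm

theorem cfValue_eq_sum_through (i : N) (σ : N → List A → A → ℝ)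
    (hJ : ∀ h ∈ J, ∀ h' ∈ J, h <+: h' → h = h') :
    G.cfValue i σ J = ∑ z ∈ G.through J, G.utility i z * G.reachOthers σ i z *
      G.pathProd (σ i) (some i) (GameTree.prefixIn J z) z := by
  rw [GameTree.cfValue_eq_sum_reachOthers i σ hJ, ← GameTree.sum_through hJ fun h z =>
    G.utility i z * G.reachOthers σ i z * G.pathProd (σ i) (some i) h z]

/-- Along `φ`, (i) and (ii) scale utility and chance, (iii) fixes the other players' factor and (iv)
player `i`'s own factor from `J` on. The strategies must be constant on the sets of `Γ`, where (iii)
and (iv) compare sequences. -/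
theorem WellFormed.cfValue_eq {k l : Finset (List A) → Finset (List A) → ℝ}
    (hΓ : Γ.WellFormed Γ' k l) (hI : I ∈ (Γ.partition i).parts) (hJ : J ∈ Γ'.subInfoSets i I)
    (hJ' : J' ∈ Γ'.subInfoSets i I) {σ : N → List A → A → ℝ}
    (hσ : ∀ j, Γ.IsMeasurable j (σ j)) :
    G.cfValue i σ J = k J J' * l J J' * G.cfValue i σ J' := by
  obtain ⟨-, -, φ, hφ, hz⟩ := hΓ.2 i I hI J hJ J' hJ'
  rw [cfValue_eq_sum_through i σ (Γ'.no_repeat i J (mem_subInfoSets.1 hJ).1),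
    cfValue_eq_sum_through i σ (Γ'.no_repeat i J' (mem_subInfoSets.1 hJ').1), Finset.mul_sum]
  refine Finset.sum_nbij φ (fun z hz => hφ.mapsTo hz) hφ.injOn hφ.surjOn fun z hzJ => ?_
  obtain ⟨hu, hc, hX, hXi⟩ := hz z hzJ
  have hH : ∀ {K : Finset (List A)} {z}, z ∈ G.through K → z ∈ G.hist := fun h =>
    GameTree.mem_hist_of_mem_terminal (Finset.mem_filter.1 h).1
  rw [reachOthers_eq_seqOthers hσ i (hH hzJ), reachOthers_eq_seqOthers hσ i (hH (hφ.mapsTo hzJ)),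
    pathProd_eq_seqOwn (hσ i) (hH hzJ), pathProd_eq_seqOwn (hσ i) (hH (hφ.mapsTo hzJ)),
    hu, hc, hX, hXi]
  ring

/-- Cells of a partition are disjoint, so `I` is its own only refinement and the identity serves as
`φ`. -/
theorem wellFormed_self (hΓ : Γ.PerfectRecall) :
    Γ.WellFormed Γ (fun _ _ => 1) (fun _ _ => 1) := by
  refine ⟨⟨hΓ, fun _ _ _ _ _ h => h⟩, fun i I hI J hJ J' hJ' => ?_⟩
  have heq : ∀ J ∈ Γ.subInfoSets i I, J = I := fun J hJ => by
    obtain ⟨hJ, hJI⟩ := mem_subInfoSets.1 hJ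
    obtain ⟨h, hh⟩ := (Γ.partition i).nonempty_of_mem_parts hJ
    exact (Γ.partition i).eq_of_mem_parts hJ hI hh (hJI hh)
  rw [heq J hJ, heq J' hJ']
  exact ⟨zero_le_one, zero_le_one, id, Set.bijOn_id _, by simp⟩

theorem wfConst_self (Γ : Info G) (i : N) :
    Γ.wfConst Γ (fun _ _ => 1) (fun _ _ => 1) i = (Γ.partition i).parts.card := by
  rw [wfConst, Finset.sum_congr rfl (g := fun _ => (1 : ℝ)) fun I hI => ?_]
  · simp
  · have hmem : I ∈ Γ.subInfoSets i I := mem_subInfoSets.2 ⟨hI, subset_rfl⟩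
    have : Nonempty ↥(Γ.subInfoSets i I ×ˢ Γ.subInfoSets i I) :=
      ⟨⟨(I, I), Finset.mk_mem_product hmem hmem⟩⟩
    simp

/-! ### Regret -/

theorem sum_mul_cfValue_switchTo (hI : I ∈ (Γ.partition i).parts) (hJ : J ⊆ I)
    (σ : N → List A → A → ℝ) (q : A → ℝ) :
    ∑ a ∈ G.actsAt I, q a * G.cfValue i (GameTree.switchTo σ i I a) J =
      ∑ h ∈ J, ∑ a ∈ G.acts h, q a * G.actionValue i σ h a := by
  have hacts : ∀ h ∈ J, G.actsAt I = G.acts h := fun h hh => actsAt_eq hI (hJ hh)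
  have hv : ∀ a ∈ G.actsAt I, q a * G.cfValue i (GameTree.switchTo σ i I a) J =
      ∑ h ∈ J, q a * G.actionValue i σ h a := fun a ha => by
    rw [GameTree.cfValue_switchTo i _ (Γ.no_repeat i I hI) (subset_playerHist hI) hJ
      (fun h hh => hacts h hh ▸ ha), Finset.mul_sum]
  rw [Finset.sum_congr rfl hv, Finset.sum_comm]
  exact Finset.sum_congr rfl fun h hh => by rw [hacts h hh]

/-- The positive regrets at `I` are a multiple of the next strategy, which is the same at every
history of `I`. Its average regret is therefore zero at each `J ⊆ I`, not just at `I`. -/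
theorem IsCFR.sum_regret_mul_eq_zero {σ : ℕ → N → List A → A → ℝ} (hσ : Γ.IsCFR i σ)
    (hI : I ∈ (Γ.partition i).parts) (hJ : J ⊆ I) (T : ℕ) :
    ∑ a ∈ G.actsAt I, max (G.cfRegret i σ T I a) 0 *
      (G.cfValue i (GameTree.switchTo (σ (T + 1)) i I a) J - G.cfValue i (σ (T + 1)) J) = 0 := by
  set S := ∑ b ∈ G.actsAt I, max (G.cfRegret i σ T I b) 0
  have hnn : ∀ b ∈ G.actsAt I, 0 ≤ max (G.cfRegret i σ T I b) 0 := fun _ _ => le_max_right _ _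
  obtain ⟨h₀, hh₀⟩ := (Γ.partition i).nonempty_of_mem_parts hI
  rcases (Finset.sum_nonneg hnn).eq_or_lt with h0 | hpos
  · refine Finset.sum_eq_zero fun a ha => ?_
    rw [(Finset.sum_eq_zero_iff_of_nonneg hnn).1 h0.symm a ha, zero_mul]
  · have hst := (hσ.1 (T + 1) (Nat.le_add_left 1 T) i)
    have hp : ∀ a ∈ G.actsAt I, max (G.cfRegret i σ T I a) 0 = S * σ (T + 1) i h₀ a := by
      intro a ha
      rw [hσ.2 T I hI h₀ hh₀ a ha, if_pos hpos, mul_div_cancel₀ _ hpos.ne']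
    have hsum : ∑ a ∈ G.actsAt I, σ (T + 1) i h₀ a = 1 := by
      rw [actsAt_eq hI hh₀]
      exact (hst.1 h₀ (subset_playerHist hI hh₀)).2.2
    have hanti : ∀ h ∈ J, ∀ h' ∈ J, h <+: h' → h = h' := fun h hh h' hh' =>
      Γ.no_repeat i I hI h (hJ hh) h' (hJ hh')
    rw [Finset.sum_congr rfl fun a ha => by rw [hp a ha, mul_assoc], ← Finset.mul_sum]
    simp only [mul_sub, Finset.sum_sub_distrib, ← Finset.sum_mul, hsum, one_mul]
    rw [GameTree.cfValue_eq_sum_actionValue i _ hanti (hJ.trans (subset_playerHist hI)),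
      sum_mul_cfValue_switchTo hI hJ, sub_eq_zero]
    congr 1
    refine Finset.sum_congr rfl fun h hh => ?_
    rw [hst.2 I hI h (hJ hh) h₀ hh₀]

/-- The switch is made on all of `I` rather than on `J`: this does not change the value at `J`, and
it keeps the profile measurable in `Γ`, as `WellFormed.cfValue_eq` requires. -/
theorem sum_expectedUtility_sub_eq (hΓ : Γ.IsAbstractionOf Γ') (σ : N → List A → A → ℝ)
    {s : List A → A → ℝ} (hs : Γ'.IsStrategy i s) {w : Finset (List A) → ℝ}
    {p : Finset (List A) → A → ℝ}
    (hw : ∀ J ∈ (Γ'.partition i).parts, ∀ h ∈ J, G.pathProd s (some i) [] h = w J)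
    (hp : ∀ J ∈ (Γ'.partition i).parts, ∀ h ∈ J, s h = p J) :
    G.expectedUtility i (Function.update σ i s) - G.expectedUtility i σ =
      ∑ I ∈ (Γ.partition i).parts, ∑ J ∈ Γ'.subInfoSets i I, w J * ∑ a ∈ G.actsAt I, p J a *
        (G.cfValue i (GameTree.switchTo σ i I a) J - G.cfValue i σ J) := by
  rw [GameTree.expectedUtility_update_sub, Γ.sum_playerHist]
  refine Finset.sum_congr rfl fun I hI => ?_
  rw [hΓ.sum_eq hI]
  refine Finset.sum_congr rfl fun J hJ => ?_
  obtain ⟨hJ, hJI⟩ := mem_subInfoSets.1 hJ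
  obtain ⟨h₀, hh₀⟩ := (Γ'.partition i).nonempty_of_mem_parts hJ
  have hsum : ∑ a ∈ G.actsAt I, p J a = 1 := by
    rw [← hp J hJ h₀ hh₀, actsAt_eq hI (hJI hh₀)]
    exact (hs.1 h₀ (subset_playerHist hJ hh₀)).2.2
  simp only [mul_sub (p J _), Finset.sum_sub_distrib, ← Finset.sum_mul, hsum, one_mul]
  rw [GameTree.cfValue_eq_sum_actionValue i _ (Γ'.no_repeat i J hJ) (subset_playerHist hJ),
    sum_mul_cfValue_switchTo hI hJI, ← Finset.sum_sub_distrib, Finset.mul_sum]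
  refine Finset.sum_congr rfl fun h hh => ?_
  rw [hw J hJ h hh, ← Finset.sum_sub_distrib, hp J hJ h hh]
  simp only [sub_mul]

theorem WellFormed.regret_le {k l : Finset (List A) → Finset (List A) → ℝ}
    (hΓ : Γ.WellFormed Γ' k l) {σ : ℕ → N → List A → A → ℝ} (hσ : Γ.IsCFR i σ) (T : ℕ) :
    Γ'.regret i σ T ≤ G.range i * Γ.wfConst Γ' k l i * √(Γ.maxActs i : ℝ) * √(T : ℝ) := by
  have habs := hΓ.1.2
  set κ : Finset (List A) → ℝ := fun I =>
    ⨆ p : ↥(Γ'.subInfoSets i I ×ˢ Γ'.subInfoSets i I), k p.1.1 p.1.2 * l p.1.1 p.1.2 with hκ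
  have hle : ∀ I, ∀ J ∈ Γ'.subInfoSets i I, ∀ J' ∈ Γ'.subInfoSets i I,
      k J J' * l J J' ≤ κ I := fun I J hJ J' hJ' =>
    le_ciSup (f := fun p : ↥(Γ'.subInfoSets i I ×ˢ Γ'.subInfoSets i I) =>
      k p.1.1 p.1.2 * l p.1.1 p.1.2) (Set.finite_range _).bddAbove
      ⟨(J, J'), Finset.mk_mem_product hJ hJ'⟩
  have hnn : ∀ I ∈ (Γ.partition i).parts, ∀ J ∈ Γ'.subInfoSets i I, ∀ J' ∈ Γ'.subInfoSets i I,
      0 ≤ k J J' * l J J' := fun I hI J hJ J' hJ' =>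
    mul_nonneg (hΓ.2 i I hI J hJ J' hJ').1 (hΓ.2 i I hI J hJ J' hJ').2.1
  have hκ0 : ∀ I ∈ (Γ.partition i).parts, 0 ≤ κ I := fun I hI => by
    obtain ⟨J, hJ⟩ := habs.subInfoSets_nonempty hI
    exact (hnn I hI J hJ J hJ).trans (hle I J hJ J hJ)
  have hΔ := G.range_nonneg i
  have hK : Γ.wfConst Γ' k l i = ∑ I ∈ (Γ.partition i).parts, κ I := rfl
  -- Nonnegativity of the bound covers the convention that an empty supremum is 0.
  refine Real.sSup_le ?_ (by
    rw [hK]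
    have := Finset.sum_nonneg hκ0
    positivity)
  rintro x ⟨s, hs, rfl⟩
  have hmeas : ∀ t ≥ 1, ∀ j, Γ.IsMeasurable j (σ t j) := fun t ht j => (hσ.1 t ht j).2
  have hprof : ∀ t ≥ 1, G.IsProfile (σ t) := fun t ht => isProfile (hσ.1 t ht)
  have hex : ∀ J : Finset (List A), ∃ w : ℝ, ∃ p : A → ℝ, J ∈ (Γ'.partition i).parts →
      ∀ h ∈ J, G.pathProd s (some i) [] h = w ∧ s h = p := by
    intro J
    by_cases hJ : J ∈ (Γ'.partition i).parts
    · obtain ⟨h₀, hh₀⟩ := (Γ'.partition i).nonempty_of_mem_parts hJ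
      exact ⟨_, _, fun _ h hh => ⟨hΓ.1.1.pathProd_eq hs.2 hJ hh hh₀, hs.2 J hJ h hh h₀ hh₀⟩⟩
    · exact ⟨0, 0, fun h => absurd h hJ⟩
  choose w p hwp using hex
  have hw : ∀ J ∈ (Γ'.partition i).parts, ∀ h ∈ J, G.pathProd s (some i) [] h = w J :=
    fun J hJ h hh => (hwp J hJ h hh).1
  have hp : ∀ J ∈ (Γ'.partition i).parts, ∀ h ∈ J, s h = p J :=
    fun J hJ h hh => (hwp J hJ h hh).2
  have hw0 : ∀ J ∈ (Γ'.partition i).parts, 0 ≤ w J := by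
    intro J hJ
    obtain ⟨h₀, hh₀⟩ := (Γ'.partition i).nonempty_of_mem_parts hJ
    rw [← hw J hJ h₀ hh₀]
    exact GameTree.pathProd_nonneg fun g a hg hgi => (hs.1 g (GameTree.mem_playerHist_of_concat
      (G.prefix_mem _ _ (subset_hist hJ hh₀) hg) hgi)).1 a
  rw [Finset.sum_congr rfl fun t _ => sum_expectedUtility_sub_eq habs (σ t) hs hw hp,
    Finset.sum_comm, hK, Finset.mul_sum, Finset.sum_mul, Finset.sum_mul]
  refine Finset.sum_le_sum fun I hI => ?_
  -- An arbitrary reference set inside `I`, against which all other regrets are measured.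
  obtain ⟨J₀, hJ₀⟩ := habs.subInfoSets_nonempty hI
  have hpart : ∀ J ∈ Γ'.subInfoSets i I, J ∈ (Γ'.partition i).parts :=
    fun J hJ => (mem_subInfoSets.1 hJ).1
  have hacts : ∀ a ∈ G.actsAt I, ∀ h ∈ I, a ∈ G.acts h := fun a ha h hh => actsAt_eq hI hh ▸ ha
  have hmain := weighted_regret_le (Γ'.subInfoSets i I) (G.actsAt I)
    (fun J t a => G.cfValue i (GameTree.switchTo (σ t) i I a) J - G.cfValue i (σ t) J)
    w (fun J => k J J₀ * l J J₀) p hΔ hJ₀ (fun J hJ => hw0 J (hpart J hJ))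
    (fun J hJ => hnn I hI J hJ J₀ hJ₀) (fun J hJ => hle I J hJ J₀ hJ₀) ?_ ?_ ?_ ?_ ?_ T
  · refine le_trans (le_of_eq ?_) (hmain.trans ?_)
    · rw [Finset.sum_comm]
      refine Finset.sum_congr rfl fun J _ => ?_
      rw [← Finset.mul_sum, Finset.sum_comm]
      simp only [Finset.mul_sum]
    · have hcard : (G.actsAt I).card ≤ Γ.maxActs i :=
        Finset.le_sup (f := fun I => (G.actsAt I).card) hI
      have := hκ0 I hI
      change G.range i * κ I * _ * _ ≤ _
      gcongr
  · intro J hJ a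
    obtain ⟨h, hh⟩ := (Γ'.partition i).nonempty_of_mem_parts (hpart J hJ)
    rw [← hp J (hpart J hJ) h hh]
    exact (hs.1 h (subset_playerHist (hpart J hJ) hh)).1 a
  · intro J hJ
    obtain ⟨h, hh⟩ := (Γ'.partition i).nonempty_of_mem_parts (hpart J hJ)
    rw [← hp J (hpart J hJ) h hh, actsAt_eq hI ((mem_subInfoSets.1 hJ).2 hh)]
    exact (hs.1 h (subset_playerHist (hpart J hJ) hh)).2.2
  · intro J hJ t ht a _
    rw [hΓ.cfValue_eq hI hJ hJ₀ (IsMeasurable.switchTo (hmeas t ht) hI a),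
      hΓ.cfValue_eq hI hJ hJ₀ (hmeas t ht), mul_sub]
  · intro t ht a ha
    have hprof' : G.IsProfile (Function.update (σ t) i s) := by
      intro j h hh
      by_cases hj : j = i
      · subst hj
        rw [Function.update_self]
        exact ⟨(hs.1 h hh).1, (hs.1 h hh).2.2⟩
      · rw [Function.update_of_ne hj]
        exact hprof t ht j h hh
    have hne : ∀ j ≠ i, GameTree.switchTo (σ t) i I a j = σ t j :=
      fun j hj => GameTree.switchTo_of_ne (σ t) hj I a
    have hsw := (hprof t ht).switchTo (i := i) (hacts a ha)
    calc _ ≤ ∑ J ∈ Γ'.subInfoSets i I,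
          w J * (G.range i * ∑ h ∈ J, G.reachOthers (σ t) i h) := by
          refine Finset.sum_le_sum fun J hJ => mul_le_mul_of_nonneg_left ?_ (hw0 J (hpart J hJ))
          have hanti := Γ'.no_repeat i J (hpart J hJ)
          have hh := subset_hist (hpart J hJ)
          rw [abs_le']
          constructor
          · refine (GameTree.cfValue_sub_le hsw (hprof t ht) hne hanti hh).trans_eq ?_
            simp only [GameTree.reachOthers_congr hne]
          · rw [neg_sub]
            exact GameTree.cfValue_sub_le (hprof t ht) hsw (fun j hj => (hne j hj).symm) hanti hh
      -- `w J` is the contribution of `s`, so together with the others' contribution it gives the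
      -- probability of reaching `h` when `s` replaces `σ t i`.
      _ = G.range i * ∑ h ∈ I, G.reach (Function.update (σ t) i s) [] h := by
          rw [habs.sum_eq hI, Finset.mul_sum]
          refine Finset.sum_congr rfl fun J hJ => ?_
          rw [mul_left_comm, Finset.mul_sum]
          congr 1
          refine Finset.sum_congr rfl fun h hh => ?_
          rw [← GameTree.reachOthers_mul_pathProd _ i, Function.update_self,
            hw J (hpart J hJ) h hh, mul_comm]
          congr 1
          exact GameTree.reachOthers_congr (fun j hj => (Function.update_of_ne hj _ _).symm) h
      _ ≤ G.range i * 1 := mul_le_mul_of_nonneg_left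
          (hprof'.sum_reach_le_one (Γ.no_repeat i I hI) (subset_hist hI)) hΔ
      _ = G.range i := mul_one _
  · intro T
    have hreg : ∀ a, ∑ t ∈ Finset.Icc 1 T, ∑ J ∈ Γ'.subInfoSets i I,
        (G.cfValue i (GameTree.switchTo (σ t) i I a) J - G.cfValue i (σ t) J) =
        G.cfRegret i σ T I a := fun a => by
      simp only [Finset.sum_sub_distrib, ← habs.cfValue_eq_sum hI]
      rw [GameTree.cfRegret, Finset.sum_sub_distrib]
    simp only [hreg]
    exact hσ.sum_regret_mul_eq_zero hI (mem_subInfoSets.1 hJ₀).2 T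

/-! ### From total to average regret -/

theorem div_le_div_sqrt_of_le_mul_sqrt {x C : ℝ} {T : ℕ} (hx : x ≤ C * √(T : ℝ)) :
    x / T ≤ C / √(T : ℝ) := by
  calc x / T ≤ C * √(T : ℝ) / T := by gcongr
    _ = C / √(T : ℝ) := by rw [mul_div_assoc, Real.sqrt_div_self', mul_one_div]

theorem WellFormed.tendsto_regret {k l : Finset (List A) → Finset (List A) → ℝ}
    (hΓ : Γ.WellFormed Γ' k l) {σ : ℕ → N → List A → A → ℝ} (hσ : Γ.IsCFR i σ) :
    Tendsto (fun T : ℕ => max (Γ'.regret i σ T) 0 / T) atTop (𝓝 0) := by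
  -- Truncation at 0 lets one constant bound both arguments of the maximum.
  set C := max (G.range i * Γ.wfConst Γ' k l i * √(Γ.maxActs i : ℝ)) 0
  have hlim : Tendsto (fun T : ℕ => C / √(T : ℝ)) atTop (𝓝 0) :=
    (Real.tendsto_sqrt_atTop.comp tendsto_natCast_atTop_atTop).const_div_atTop C
  refine squeeze_zero (fun T => by positivity) (fun T => ?_) hlim
  refine div_le_div_sqrt_of_le_mul_sqrt (max_le ((hΓ.regret_le hσ T).trans ?_) (by positivity))
  exact mul_le_mul_of_nonneg_right (le_max_left _ _) (Real.sqrt_nonneg _)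

end Info

theorem theorem1 {N A : Type*} [Fintype N] [DecidableEq N] [Fintype A] [DecidableEq A]
    (G : GameTree N A) (Γ : Info G) (i : N) (σ : ℕ → N → List A → A → ℝ) (hσ : Γ.IsCFR i σ) :
    (∀ (Γ' : Info G) (k l : Finset (List A) → Finset (List A) → ℝ), Γ.WellFormed Γ' k l →
      (∀ T : ℕ, 1 ≤ T →
        Γ'.regret i σ T / T ≤
          G.range i * Γ.wfConst Γ' k l i * √(Γ.maxActs i : ℝ) / √(T : ℝ)) ∧
      Tendsto (fun T : ℕ => max (Γ'.regret i σ T) 0 / T) atTop (𝓝 0)) ∧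
    (Γ.PerfectRecall →
      Γ.WellFormed Γ (fun _ _ => 1) (fun _ _ => 1) ∧
      ∀ T : ℕ, 1 ≤ T →
        Γ.regret i σ T / T ≤
          G.range i * ((Γ.partition i).parts.card : ℝ) * √(Γ.maxActs i : ℝ) / √(T : ℝ)) := by
  refine ⟨fun Γ' k l hΓ => ⟨fun T _ => Info.div_le_div_sqrt_of_le_mul_sqrt (hΓ.regret_le hσ T),
    hΓ.tendsto_regret hσ⟩, fun hΓ => ⟨Info.wellFormed_self hΓ, fun T _ => ?_⟩⟩
  rw [← Γ.wfConst_self i]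
  exact Info.div_le_div_sqrt_of_le_mul_sqrt ((Info.wellFormed_self hΓ).regret_le hσ T)
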